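/- Let $J_1$ be the Bessel function of the first kind of order $1$, $I_1$ the modified Bessel function of the first kind of order $1$, $Y_0$ the Bessel function of the second kind (Weber's function) of order $0$, and $K_0$ the modified Bessel function of the second kind (Macdonald's function) of order $0$. That is, with $H_k=\sum_{j=1}^k 1/j$ and $\gamma$ the Euler–Mascheroni constant, for $x>0$, $$J_n(x)=\sum_{k\ge0}\frac{(-1)^k}{k!\,(n+k)!}\Big(\frac x2\Big)^{n+2k},\qquad I_n(x)=\sum_{k\ge0}\frac{1}{k!\,(n+k)!}\Big(\frac x2\Big)^{n+2k},$$ $$Y_0(x)=\frac2\pi\ln\Big(\frac x2\Big)J_0(x)-\frac2\pi\sum_{k\ge0}\frac{(-1)^k(H_k-\gamma)}{(k!)^2}\Big(\frac x2\Big)^{2k},\qquad K_0(x)=-\ln\Big(\frac x2\Big)I_0(x)+\sum_{k\ge0}\frac{H_k-\gamma}{(k!)^2}\Big(\frac x2\Big)^{2k}.$$ Then for every real $a$ with $0<a<1$ the function $x\mapsto x\,J_1(ax)\,I_1(ax)\,Y_0(x)\,K_0(x)$ is absolutely integrable on $(0,\infty)$, and $$\int_0^\infty x\,J_1(ax)\,I_1(ax)\,Y_0(x)\,K_0(x)\,dx=-\frac{1}{2\pi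 a^2}\,\ln(1-a^4).$$ -/

import Mathlib

noncomputable section

namespace BesselFn

/-- The digamma function at the positive integer `k + 1`: `ψ(k+1) = H_k - γ`, where `H_k` is the
`k`-th harmonic number and `γ` is the Euler-Mascheroni constant. -/
def psiSucc (k : ℕ) : ℝ := (harmonic k : ℝ) - Real.eulerMascheroniConstant

/-- The Bessel function of the first kind `J_n`, of integer order `n ≥ 0`. -/
def J (n : ℕ) (x : ℝ) : ℝ :=
  ∑' k : ℕ, (-1 : ℝ) ^ k / ((k.factorial : ℝ) * ((n + k).factorial : ℝ)) * (x / 2) ^ (n + 2 * k)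

/-- The modified Bessel function of the first kind `I_n`, of integer order `n ≥ 0`. -/
def I (n : ℕ) (x : ℝ) : ℝ :=
  ∑' k : ℕ, 1 / ((k.factorial : ℝ) * ((n + k).factorial : ℝ)) * (x / 2) ^ (n + 2 * k)

/-- The Bessel function of the second kind `Y_n` (Weber's function, also written `N_n`), of integer
order `n ≥ 0`, for `x > 0`. -/
def Y (n : ℕ) (x : ℝ) : ℝ :=
  2 / Real.pi * Real.log (x / 2) * J n x
    - 1 / Real.pi * ∑ k ∈ Finset.range n,
        ((n - k - 1).factorial : ℝ) / (k.factorial : ℝ) * ((x / 2) ^ (2 * k) / (x / 2) ^ n)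
    - 1 / Real.pi * ∑' k : ℕ, (psiSucc k + psiSucc (n + k)) *
        ((-1 : ℝ) ^ k / ((k.factorial : ℝ) * ((n + k).factorial : ℝ)) * (x / 2) ^ (n + 2 * k))

/-- The modified Bessel function of the second kind `K_n` (Macdonald's function), of integer order
`n ≥ 0`, for `x > 0`. -/
def K (n : ℕ) (x : ℝ) : ℝ :=
  (-1 : ℝ) ^ (n + 1) * Real.log (x / 2) * I n x
    + 1 / 2 * ∑ k ∈ Finset.range n, (-1 : ℝ) ^ k *
        (((n - k - 1).factorial : ℝ) / (k.factorial : ℝ) * ((x / 2) ^ (2 * k) / (x / 2) ^ n))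
    + (-1 : ℝ) ^ n * (1 / 2) * ∑' k : ℕ, (psiSucc k + psiSucc (n + k)) *
        (1 / ((k.factorial : ℝ) * ((n + k).factorial : ℝ)) * (x / 2) ^ (n + 2 * k))

end BesselFn

end

/-! Multiply the integral by `a ^ 2`. Since (z J₁)' = z J₀ and (z I₁)' = z I₀, differentiating under
the integral sign turns J₁ I₁ into x(J₀ I₁ + J₁ I₀)(ax), and that integral is elementary. With θ = x
d/dx, u = J₀(ax) I₀(ax) satisfies θ³(θ - 2)u = -4a⁴x⁴u, and Y₀ K₀ satisfies the same equation with a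
= 1. As θ³u = -2(ax)³(J₀ I₁ + J₁ I₀)(ax), Lagrange's identity makes 1 - a⁴ times the new integrand
an exact derivative, up to a constant factor. The explicit antiderivative is `concomitant`, with
value 8/π at 0 and limit 0 at infinity. Hence `scaledIntegral` has derivative 2a³/(π(1 - a⁴)),
vanishes at 0 and is continuous there, which gives the logarithm (`scaledIntegral_eq`).

The analytic input is growth at infinity: J₀, J₁, Y₀, Y₁ bounded, I₀, I₁ at most eˣ, K₀, K₁ of order
e⁻ˣ, so a < 1 leaves exponential decay. No asymptotic expansion is needed: each bound comes from a
monotone quantity. The delicate one is K, whose series does not show its decay; a crude termwise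
bound (`abs_K_zero_le`) and the Wronskian identify it as the decaying solution. -/

namespace BesselFn

open Filter Topology MeasureTheory

/-! ### Coefficient sequences of exponential growth -/

/-- A real sequence of at most exponential growth. -/
def ExpBounded (b : ℕ → ℝ) : Prop :=
  ∃ C r : ℝ, 0 ≤ C ∧ 0 ≤ r ∧ ∀ k, |b k| ≤ C * r ^ k

/-- The even series `∑ b_k / (k!)² (x/2)^(2k)`. -/
noncomputable def evenSeries (b : ℕ → ℝ) (x : ℝ) : ℝ :=
  ∑' k : ℕ, b k / ((k.factorial : ℝ) * (k.factorial : ℝ)) * (x / 2) ^ (2 * k)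

/-- The odd series `∑ b_k / (k! (k+1)!) (x/2)^(2k+1)`. -/
noncomputable def oddSeries (b : ℕ → ℝ) (x : ℝ) : ℝ :=
  ∑' k : ℕ, b k / ((k.factorial : ℝ) * ((k + 1).factorial : ℝ)) * (x / 2) ^ (2 * k + 1)

theorem ExpBounded.mul {b c : ℕ → ℝ} (hb : ExpBounded b) (hc : ExpBounded c) :
    ExpBounded fun k => b k * c k := by
  obtain ⟨C, r, hC, hr, h⟩ := hb
  obtain ⟨D, s, hD, hs, h'⟩ := hc
  refine ⟨C * D, r * s, by positivity, by positivity, fun k => ?_⟩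
  rw [abs_mul]
  calc |b k| * |c k| ≤ (C * r ^ k) * (D * s ^ k) :=
        mul_le_mul (h k) (h' k) (abs_nonneg _) (by positivity)
    _ = C * D * (r * s) ^ k := by rw [mul_pow]; ring

theorem ExpBounded.of_abs_le {b c : ℕ → ℝ} (hc : ExpBounded c) (h : ∀ k, |b k| ≤ |c k|) :
    ExpBounded b := by
  obtain ⟨C, r, hC, hr, h'⟩ := hc
  exact ⟨C, r, hC, hr, fun k => (h k).trans (h' k)⟩

theorem expBounded_pow (σ : ℝ) : ExpBounded fun k => σ ^ k :=
  ⟨1, |σ|, zero_le_one, abs_nonneg _, fun k => by rw [abs_pow, one_mul]⟩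

theorem expBounded_one : ExpBounded fun _ => 1 := by
  simpa using expBounded_pow 1

theorem expBounded_const (c : ℝ) : ExpBounded fun _ => c :=
  ⟨|c|, 1, abs_nonneg _, zero_le_one, fun k => by simp⟩

theorem ExpBounded.add {b c : ℕ → ℝ} (hb : ExpBounded b) (hc : ExpBounded c) :
    ExpBounded fun k => b k + c k := by
  obtain ⟨C, r, hC, hr, h⟩ := hb
  obtain ⟨D, s, hD, hs, h'⟩ := hc
  refine ⟨C + D, r + s, by positivity, by positivity, fun k => ?_⟩
  calc |b k + c k| ≤ |b k| + |c k| := abs_add_le _ _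
    _ ≤ C * r ^ k + D * s ^ k := add_le_add (h k) (h' k)
    _ ≤ C * (r + s) ^ k + D * (r + s) ^ k := by gcongr <;> linarith
    _ = (C + D) * (r + s) ^ k := by ring

theorem expBounded_natCast : ExpBounded fun k => (k : ℝ) := by
  refine ⟨1, 2, zero_le_one, zero_le_two, fun k => ?_⟩
  beta_reduce
  rw [one_mul, abs_of_nonneg (Nat.cast_nonneg k)]
  have h : k ≤ 2 ^ k := Nat.lt_two_pow_self.le
  exact_mod_cast h

theorem expBounded_inv_succ : ExpBounded fun k => 1 / ((k : ℝ) + 1) := by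
  refine expBounded_one.of_abs_le fun k => ?_
  rw [abs_one, abs_of_nonneg (by positivity)]
  exact div_le_one_of_le₀ (by linarith [Nat.cast_nonneg (α := ℝ) k]) (by positivity)

theorem ExpBounded.shift {b : ℕ → ℝ} (hb : ExpBounded b) : ExpBounded fun k => b (k + 1) := by
  obtain ⟨C, r, hC, hr, h⟩ := hb
  refine ⟨C * r, r, by positivity, hr, fun k => (h (k + 1)).trans (le_of_eq ?_)⟩
  ring

theorem ExpBounded.natCast_mul_pred {b : ℕ → ℝ} (hb : ExpBounded b) :
    ExpBounded fun k => (k : ℝ) * b (k - 1) := by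
  refine expBounded_natCast.mul ?_
  obtain ⟨C, r, hC, hr, h⟩ := hb
  -- The base `r + 1` is at least 1, so its powers increase and the truncated exponent `k - 1` can
  -- be raised to `k`.
  refine ⟨C, r + 1, hC, by positivity, fun k => (h (k - 1)).trans ?_⟩
  refine mul_le_mul_of_nonneg_left ?_ hC
  calc r ^ (k - 1) ≤ (r + 1) ^ (k - 1) := by gcongr; linarith
    _ ≤ (r + 1) ^ k := pow_le_pow_right₀ (by linarith) (by omega)

/-! ### Estimates for the digamma values -/

theorem psiSucc_lt_log (k : ℕ) : psiSucc k < Real.log (k + 1) := by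
  have := Real.eulerMascheroniSeq_lt_eulerMascheroniConstant k
  rw [Real.eulerMascheroniSeq] at this
  rw [psiSucc]
  linarith

theorem psiSucc_succ (k : ℕ) : psiSucc (k + 1) = psiSucc k + 1 / ((k : ℝ) + 1) := by
  rw [psiSucc, psiSucc, harmonic_succ]
  push_cast
  ring

theorem log_sub_lt_psiSucc (k : ℕ) :
    Real.log (k + 1) - 1 / ((k : ℝ) + 1) < psiSucc k := by
  have := Real.eulerMascheroniConstant_lt_eulerMascheroniSeq' (k + 1)
  rw [Real.eulerMascheroniSeq', if_neg (by omega)] at this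
  have h2 := psiSucc_succ k
  rw [psiSucc] at h2
  push_cast at this
  linarith

theorem expBounded_psiSucc : ExpBounded psiSucc := by
  have h : ExpBounded fun k => ((k + 1 : ℕ) : ℝ) := expBounded_natCast.shift
  refine h.of_abs_le fun k => ?_
  rw [abs_of_nonneg (Nat.cast_nonneg (k + 1) : (0 : ℝ) ≤ ((k + 1 : ℕ) : ℝ))]
  have h0 : (0 : ℝ) ≤ k := Nat.cast_nonneg k
  have h1 := psiSucc_lt_log k
  have h2 := log_sub_lt_psiSucc k
  have h3 := Real.log_le_sub_one_of_pos (x := (k : ℝ) + 1) (by positivity)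
  have h4 := Real.log_nonneg (x := (k : ℝ) + 1) (by linarith)
  have h5 : 1 / ((k : ℝ) + 1) ≤ 1 := div_le_one_of_le₀ (by linarith) (by positivity)
  push_cast
  rw [abs_le]
  constructor <;> linarith

/-! ### Even and odd Bessel-type series with general coefficients -/

section Series

variable {b : ℕ → ℝ}

theorem ExpBounded.summable_even (hb : ExpBounded b) (x : ℝ) :
    Summable fun k : ℕ => b k / ((k.factorial : ℝ) * (k.factorial : ℝ)) * (x / 2) ^ (2 * k) := by
  obtain ⟨C, r, hC, hr, h⟩ := hb
  refine Summable.of_norm_bounded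
    ((Real.summable_pow_div_factorial (r * (x / 2) ^ 2)).mul_left C) fun k => ?_
  have hk : (1 : ℝ) ≤ k.factorial := by exact_mod_cast Nat.one_le_iff_ne_zero.2 k.factorial_ne_zero
  rw [Real.norm_eq_abs, abs_mul, abs_div, pow_mul, abs_of_pos (by positivity :
    (0 : ℝ) < (k.factorial : ℝ) * (k.factorial : ℝ)), abs_of_nonneg (by positivity :
    (0 : ℝ) ≤ ((x / 2) ^ 2) ^ k), mul_pow]
  calc |b k| / ((k.factorial : ℝ) * (k.factorial : ℝ)) * ((x / 2) ^ 2) ^ k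
      ≤ (C * r ^ k) / ((k.factorial : ℝ) * 1) * ((x / 2) ^ 2) ^ k := by
        gcongr
        exact h k
    _ = _ := by ring

theorem oddSeries_eq (b : ℕ → ℝ) (x : ℝ) :
    oddSeries b x = x / 2 * evenSeries (fun k => b k * (1 / ((k : ℝ) + 1))) x := by
  rw [oddSeries, evenSeries, ← tsum_mul_left]
  refine tsum_congr fun k => ?_
  rw [Nat.factorial_succ]
  push_cast
  have : (k.factorial : ℝ) ≠ 0 := by positivity
  have : (k : ℝ) + 1 ≠ 0 := by positivity
  field_simp
  ring

theorem ExpBounded.summable_odd (hb : ExpBounded b) (x : ℝ) :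
    Summable fun k : ℕ =>
      b k / ((k.factorial : ℝ) * ((k + 1).factorial : ℝ)) * (x / 2) ^ (2 * k + 1) := by
  refine (((hb.mul expBounded_inv_succ).summable_even x).mul_left (x / 2)).congr fun k => ?_
  rw [Nat.factorial_succ]
  push_cast
  have : (k.factorial : ℝ) ≠ 0 := by positivity
  have : (k : ℝ) + 1 ≠ 0 := by positivity
  field_simp
  ring

/-- Termwise differentiation on a ball: one factor k! absorbs the k from the derivative, and the
other still gives a summable exponential bound. -/
theorem ExpBounded.hasDerivAt_even (hb : ExpBounded b) (x : ℝ) :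
    HasDerivAt (evenSeries b) (oddSeries (fun k => b (k + 1)) x) x := by
  have hs := hb.summable_even 0
  obtain ⟨C, r, hC, hr, h⟩ := hb
  -- The ball of radius 2R contains x and the base point 0, and R ≥ 1 allows the exponent `2 * k -
  -- 1` to be raised to `2 * k`.
  set R : ℝ := |x| / 2 + 1 with hR
  have hR1 : 1 ≤ R := by rw [hR]; linarith [abs_nonneg x]
  have hu : Summable fun k : ℕ => C * ((r * R ^ 2) ^ k / (k.factorial : ℝ)) :=
    (Real.summable_pow_div_factorial _).mul_left C
  have hbd : ∀ (k : ℕ), ∀ y ∈ Metric.ball (0 : ℝ) (2 * R),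
      ‖b k / ((k.factorial : ℝ) * (k.factorial : ℝ)) * (k * (y / 2) ^ (2 * k - 1))‖
        ≤ C * ((r * R ^ 2) ^ k / (k.factorial : ℝ)) := by
    intro k y hy
    have hy' : |y / 2| ≤ R := by
      rw [Metric.mem_ball, dist_zero_right, Real.norm_eq_abs] at hy
      rw [abs_div, abs_two]; linarith
    have hkf : (k : ℝ) ≤ k.factorial := by exact_mod_cast Nat.self_le_factorial k
    rw [Real.norm_eq_abs, abs_mul, abs_div, abs_mul (k : ℝ), abs_pow, Nat.abs_cast,
      abs_of_pos (by positivity : (0 : ℝ) < (k.factorial : ℝ) * (k.factorial : ℝ)), mul_pow,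
      ← pow_mul]
    calc |b k| / ((k.factorial : ℝ) * (k.factorial : ℝ)) * (k * |y / 2| ^ (2 * k - 1))
        ≤ (C * r ^ k) / ((k.factorial : ℝ) * (k.factorial : ℝ)) *
            (k.factorial * R ^ (2 * k)) := by
          gcongr
          · exact h k
          · calc |y / 2| ^ (2 * k - 1) ≤ R ^ (2 * k - 1) := by gcongr
              _ ≤ R ^ (2 * k) := pow_le_pow_right₀ hR1 (by omega)
      _ = _ := by field_simp
  have hx : x ∈ Metric.ball (0 : ℝ) (2 * R) := by
    rw [Metric.mem_ball, dist_zero_right, Real.norm_eq_abs]; linarith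
  have key := hasDerivAt_tsum_of_isPreconnected (𝕜 := ℝ) (F := ℝ) (y₀ := 0) (y := x)
    (g := fun (k : ℕ) (y : ℝ) =>
      b k / ((k.factorial : ℝ) * (k.factorial : ℝ)) * (y / 2) ^ (2 * k))
    (g' := fun (k : ℕ) (y : ℝ) =>
      b k / ((k.factorial : ℝ) * (k.factorial : ℝ)) * (k * (y / 2) ^ (2 * k - 1)))
    hu Metric.isOpen_ball (convex_ball _ _).isPreconnected ?_ hbd
    (Metric.mem_ball_self (by linarith)) hs hx
  · refine key.congr_deriv ?_
    rw [Summable.tsum_eq_zero_add (Summable.of_norm_bounded hu fun k => hbd k x hx), oddSeries]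
    simp only [Nat.cast_zero, zero_mul, mul_zero, zero_add]
    refine tsum_congr fun k => ?_
    rw [Nat.factorial_succ, show 2 * (k + 1) - 1 = 2 * k + 1 by omega]
    push_cast
    have : (k.factorial : ℝ) ≠ 0 := by positivity
    have : (k : ℝ) + 1 ≠ 0 := by positivity
    field_simp
  · intro k y _
    refine ((((hasDerivAt_id y).div_const 2).pow (2 * k)).const_mul
      (b k / ((k.factorial : ℝ) * (k.factorial : ℝ)))).congr_deriv ?_
    simp only [id]
    push_cast
    ring

theorem ExpBounded.continuous_even (hb : ExpBounded b) : Continuous (evenSeries b) :=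
  continuous_iff_continuousAt.2 fun x => (hb.hasDerivAt_even x).continuousAt

theorem ExpBounded.continuous_odd (hb : ExpBounded b) : Continuous (oddSeries b) := by
  have : oddSeries b = fun x => x / 2 * evenSeries (fun k => b k * (1 / ((k : ℝ) + 1))) x :=
    funext (oddSeries_eq b)
  rw [this]
  exact (continuous_id.div_const 2).mul (hb.mul expBounded_inv_succ).continuous_even

theorem evenSeries_zero (b : ℕ → ℝ) : evenSeries b 0 = b 0 := by
  rw [evenSeries, tsum_eq_single 0]
  · simp
  · intro k hk
    simp [hk]

theorem oddSeries_zero (b : ℕ → ℝ) : oddSeries b 0 = 0 := by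
  rw [oddSeries_eq]; simp

/-- The product is twice an even series with coefficients k b(k-1); the factor k kills the spurious
value at k = 0. Differentiation shifts these to (k+1) b(k), and the odd-series denominator cancels
k+1. This is the common source of (z J₁)' = z J₀ and (z I₁)' = z I₀. -/
theorem ExpBounded.hasDerivAt_mul_odd (hb : ExpBounded b) (x : ℝ) :
    HasDerivAt (fun y => y * oddSeries b y) (x * evenSeries b x) x := by
  have h : (fun y => y * oddSeries b y)
      = fun y => 2 * evenSeries (fun k => (k : ℝ) * b (k - 1)) y := by
    funext y
    rw [evenSeries, (hb.natCast_mul_pred.summable_even y).tsum_eq_zero_add, oddSeries,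
      ← tsum_mul_left]
    simp only [Nat.cast_zero, zero_mul, zero_div, zero_add]
    rw [← tsum_mul_left]
    refine tsum_congr fun k => ?_
    rw [Nat.factorial_succ, Nat.add_sub_cancel, mul_add, pow_add]
    push_cast
    have : (k.factorial : ℝ) ≠ 0 := by positivity
    have : (k : ℝ) + 1 ≠ 0 := by positivity
    field_simp
    ring
  rw [h]
  refine ((hb.natCast_mul_pred.hasDerivAt_even x).const_mul 2).congr_deriv ?_
  rw [oddSeries_eq]
  have : (fun k : ℕ => ((k + 1 : ℕ) : ℝ) * b (k + 1 - 1) * (1 / ((k : ℝ) + 1))) = b := by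
    funext k
    have : (k : ℝ) + 1 ≠ 0 := by positivity
    rw [Nat.add_sub_cancel, Nat.cast_succ]
    field_simp
  rw [this]
  ring

theorem ExpBounded.hasDerivAt_odd (hb : ExpBounded b) {x : ℝ} (hx : x ≠ 0) :
    HasDerivAt (oddSeries b) (evenSeries b x - oddSeries b x / x) x := by
  have h := (hb.hasDerivAt_mul_odd x).div (hasDerivAt_id x) hx
  refine (h.congr_of_eventuallyEq ?_).congr_deriv ?_
  · filter_upwards [isOpen_ne.mem_nhds hx] with y hy
    have hy' : y ≠ 0 := hy
    simp only [id, Pi.div_apply]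
    field_simp
  · simp only [id]
    field_simp

theorem evenSeries_const_mul (c : ℝ) (b : ℕ → ℝ) (x : ℝ) :
    evenSeries (fun k => c * b k) x = c * evenSeries b x := by
  rw [evenSeries, evenSeries, ← tsum_mul_left]
  exact tsum_congr fun k => by ring

theorem oddSeries_const_mul (c : ℝ) (b : ℕ → ℝ) (x : ℝ) :
    oddSeries (fun k => c * b k) x = c * oddSeries b x := by
  rw [oddSeries, oddSeries, ← tsum_mul_left]
  exact tsum_congr fun k => by ring

theorem ExpBounded.evenSeries_add {c : ℕ → ℝ} (hb : ExpBounded b) (hc : ExpBounded c) (x : ℝ) :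
    evenSeries (fun k => b k + c k) x = evenSeries b x + evenSeries c x := by
  rw [evenSeries, evenSeries, evenSeries, ← (hb.summable_even x).tsum_add (hc.summable_even x)]
  exact tsum_congr fun k => by ring

theorem ExpBounded.evenSeries_mono {c : ℕ → ℝ} (hb : ExpBounded b) (hc : ExpBounded c)
    (h : ∀ k, b k ≤ c k) (x : ℝ) : evenSeries b x ≤ evenSeries c x := by
  refine (hb.summable_even x).tsum_le_tsum (fun k => ?_) (hc.summable_even x)
  have : (0 : ℝ) ≤ (x / 2) ^ (2 * k) := by rw [pow_mul]; positivity
  gcongr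
  exact h k

theorem evenSeries_natCast (x : ℝ) :
    evenSeries (fun k => (k : ℝ)) x = x / 2 * oddSeries (fun _ => 1) x := by
  rw [evenSeries, (expBounded_natCast.summable_even x).tsum_eq_zero_add, oddSeries,
    ← tsum_mul_left]
  simp only [Nat.cast_zero, zero_mul, zero_div, zero_add]
  refine tsum_congr fun k => ?_
  rw [Nat.factorial_succ, mul_add, pow_add]
  push_cast
  have : (k.factorial : ℝ) ≠ 0 := by positivity
  have : (k : ℝ) + 1 ≠ 0 := by positivity
  field_simp
  ring

end Series

/-! ### Logarithmic solutions, treated together for σ = ±1 -/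

/-- The logarithmic companion of `∑ σ^k / (k!)² (x/2)^(2k)`; it is `π Y₀ / 2` for `σ = -1` and
`-K₀` for `σ = 1`. -/
noncomputable def logSol (σ x : ℝ) : ℝ :=
  Real.log (x / 2) * evenSeries (fun k => σ ^ k) x - evenSeries (fun k => σ ^ k * psiSucc k) x

/-- The function `x (logSol σ)'(x)`, extended continuously to `x = 0`. -/
noncomputable def logSolDeriv (σ x : ℝ) : ℝ :=
  evenSeries (fun k => σ ^ k) x + σ * (x * Real.log (x / 2) * oddSeries (fun k => σ ^ k) x
    - x * oddSeries (fun k => σ ^ k * psiSucc (k + 1)) x)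

theorem evenSeries_pow_hasDerivAt (σ x : ℝ) :
    HasDerivAt (evenSeries fun k => σ ^ k) (σ * oddSeries (fun k => σ ^ k) x) x := by
  refine ((expBounded_pow σ).hasDerivAt_even x).congr_deriv ?_
  rw [← oddSeries_const_mul]
  simp only [pow_succ']

theorem hasDerivAt_log_half {x : ℝ} (hx : 0 < x) :
    HasDerivAt (fun y => Real.log (y / 2)) (1 / x) x := by
  refine (((hasDerivAt_id x).div_const 2).log (by simpa using hx.ne')).congr_deriv ?_
  simp only [id]
  field_simp

theorem hasDerivAt_logSol (σ : ℝ) {x : ℝ} (hx : 0 < x) :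
    HasDerivAt (logSol σ) (logSolDeriv σ x / x) x := by
  have h1 := (hasDerivAt_log_half hx).mul (evenSeries_pow_hasDerivAt σ x)
  have h2 := ((expBounded_pow σ).mul expBounded_psiSucc).hasDerivAt_even x
  refine (h1.sub h2).congr_deriv ?_
  have h3 : oddSeries (fun k => σ ^ (k + 1) * psiSucc (k + 1)) x
      = σ * oddSeries (fun k => σ ^ k * psiSucc (k + 1)) x := by
    rw [← oddSeries_const_mul]
    simp only [pow_succ', mul_assoc]
  rw [h3, logSolDeriv]
  field_simp
  ring

/-- This is the Bessel equation (x u')' = σ x u. The term from differentiating the logarithm cancels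
against the increment ψ(k+2) - ψ(k+1) = 1/(k+1). -/
theorem hasDerivAt_logSolDeriv (σ : ℝ) {x : ℝ} (hx : 0 < x) :
    HasDerivAt (logSolDeriv σ) (σ * x * logSol σ x) x := by
  have hp := expBounded_pow σ
  have h1 := (hasDerivAt_log_half hx).mul (hp.hasDerivAt_mul_odd x)
  have h2 := (hp.mul expBounded_psiSucc.shift).hasDerivAt_mul_odd x
  have h3 := (evenSeries_pow_hasDerivAt σ x).add ((h1.sub h2).const_mul σ)
  have h4 : logSolDeriv σ = (evenSeries fun k => σ ^ k) + fun y => σ *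
      (((fun y => Real.log (y / 2)) * fun y => y * oddSeries (fun k => σ ^ k) y)
        - fun y => y * oddSeries (fun k => σ ^ k * psiSucc (k + 1)) y) y := by
    funext y
    simp only [logSolDeriv, Pi.add_apply, Pi.sub_apply, Pi.mul_apply]
    ring
  rw [h4]
  refine h3.congr_deriv ?_
  have h5 : evenSeries (fun k => σ ^ k * psiSucc (k + 1)) x
      = evenSeries (fun k => σ ^ k * psiSucc k) x
        + evenSeries (fun k => σ ^ k * (1 / ((k : ℝ) + 1))) x := by
    rw [← (hp.mul expBounded_psiSucc).evenSeries_add (hp.mul expBounded_inv_succ)]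
    simp only [psiSucc_succ, mul_add]
  rw [h5, logSol, oddSeries_eq]
  field_simp
  ring

theorem continuous_mul_log_half : Continuous fun x : ℝ => x * Real.log (x / 2) := by
  have h : (fun x : ℝ => x * Real.log (x / 2))
      = fun x => 2 * ((fun y => y * Real.log y) (x / 2)) := by
    funext x; ring
  rw [h]
  exact (Real.continuous_mul_log.comp (continuous_id.div_const 2)).const_mul 2

theorem continuous_mul_logSol (σ : ℝ) : Continuous fun x => x * logSol σ x := by
  have h : (fun x => x * logSol σ x) = fun x => x * Real.log (x / 2) *
      evenSeries (fun k => σ ^ k) x - x * evenSeries (fun k => σ ^ k * psiSucc k) x := by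
    funext x; rw [logSol]; ring
  rw [h]
  exact (continuous_mul_log_half.mul (expBounded_pow σ).continuous_even).sub
    (continuous_id.mul ((expBounded_pow σ).mul expBounded_psiSucc).continuous_even)

theorem continuous_logSolDeriv (σ : ℝ) : Continuous (logSolDeriv σ) :=
  (expBounded_pow σ).continuous_even.add (continuous_const.mul
    ((continuous_mul_log_half.mul (expBounded_pow σ).continuous_odd).sub
    (continuous_id.mul ((expBounded_pow σ).mul expBounded_psiSucc.shift).continuous_odd)))

theorem logSolDeriv_zero (σ : ℝ) : logSolDeriv σ 0 = 1 := by
  rw [logSolDeriv, evenSeries_zero]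
  simp

/-! ### The Bessel functions of order `0` and `1` -/

theorem J_zero_eq : J 0 = evenSeries fun k => (-1) ^ k := by
  funext x; simp only [J, evenSeries, zero_add]

theorem J_one_eq : J 1 = oddSeries fun k => (-1) ^ k := by
  funext x; simp only [J, oddSeries, add_comm 1]

theorem I_zero_eq : I 0 = evenSeries fun k => 1 ^ k := by
  funext x; simp only [I, evenSeries, zero_add, one_pow]

theorem I_one_eq : I 1 = oddSeries fun k => 1 ^ k := by
  funext x; simp only [I, oddSeries, add_comm 1, one_pow]

theorem Y_zero_eq (x : ℝ) : Y 0 x = 2 / Real.pi * logSol (-1) x := by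
  have h : ∑' k : ℕ, (psiSucc k + psiSucc (0 + k)) * ((-1 : ℝ) ^ k /
      ((k.factorial : ℝ) * ((0 + k).factorial : ℝ)) * (x / 2) ^ (0 + 2 * k))
      = 2 * evenSeries (fun k => (-1) ^ k * psiSucc k) x := by
    rw [evenSeries, ← tsum_mul_left]
    refine tsum_congr fun k => ?_
    rw [zero_add, zero_add]
    ring
  rw [Y, h, logSol, J_zero_eq, Finset.sum_range_zero]
  ring

theorem K_zero_eq (x : ℝ) : K 0 x = -logSol 1 x := by
  have h : ∑' k : ℕ, (psiSucc k + psiSucc (0 + k)) * (1 /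
      ((k.factorial : ℝ) * ((0 + k).factorial : ℝ)) * (x / 2) ^ (0 + 2 * k))
      = 2 * evenSeries (fun k => 1 ^ k * psiSucc k) x := by
    rw [evenSeries, ← tsum_mul_left]
    refine tsum_congr fun k => ?_
    rw [zero_add, zero_add, one_pow]
    ring
  rw [K, h, logSol, I_zero_eq, Finset.sum_range_zero]
  ring

/-- `x Y₁(x) = -x Y₀'(x)`, extended continuously to `0`. -/
noncomputable def xY1 (x : ℝ) : ℝ := -(2 / Real.pi * logSolDeriv (-1) x)

/-- `x K₁(x) = -x K₀'(x)`, extended continuously to `0`. -/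
noncomputable def xK1 (x : ℝ) : ℝ := logSolDeriv 1 x

theorem hasDerivAt_J_zero (x : ℝ) : HasDerivAt (J 0) (-J 1 x) x := by
  rw [J_zero_eq, J_one_eq]
  exact (evenSeries_pow_hasDerivAt (-1) x).congr_deriv (neg_one_mul _)

theorem hasDerivAt_I_zero (x : ℝ) : HasDerivAt (I 0) (I 1 x) x := by
  rw [I_zero_eq, I_one_eq]
  exact (evenSeries_pow_hasDerivAt 1 x).congr_deriv (one_mul _)

theorem hasDerivAt_mul_J_one (x : ℝ) : HasDerivAt (fun y => y * J 1 y) (x * J 0 x) x := by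
  rw [J_zero_eq, J_one_eq]
  exact (expBounded_pow (-1)).hasDerivAt_mul_odd x

theorem hasDerivAt_mul_I_one (x : ℝ) : HasDerivAt (fun y => y * I 1 y) (x * I 0 x) x := by
  rw [I_zero_eq, I_one_eq]
  exact (expBounded_pow 1).hasDerivAt_mul_odd x

theorem hasDerivAt_J_one {x : ℝ} (hx : x ≠ 0) : HasDerivAt (J 1) (J 0 x - J 1 x / x) x := by
  rw [J_zero_eq, J_one_eq]
  exact (expBounded_pow (-1)).hasDerivAt_odd hx

theorem hasDerivAt_I_one {x : ℝ} (hx : x ≠ 0) : HasDerivAt (I 1) (I 0 x - I 1 x / x) x := by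
  rw [I_zero_eq, I_one_eq]
  exact (expBounded_pow 1).hasDerivAt_odd hx

theorem hasDerivAt_Y_zero {x : ℝ} (hx : 0 < x) : HasDerivAt (Y 0) (-(xY1 x / x)) x := by
  rw [show Y 0 = fun x => 2 / Real.pi * logSol (-1) x from funext Y_zero_eq]
  refine ((hasDerivAt_logSol (-1) hx).const_mul _).congr_deriv ?_
  rw [xY1]; ring

theorem hasDerivAt_K_zero {x : ℝ} (hx : 0 < x) : HasDerivAt (K 0) (-(xK1 x / x)) x := by
  rw [show K 0 = fun x => -logSol 1 x from funext K_zero_eq]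
  exact (hasDerivAt_logSol 1 hx).neg

theorem hasDerivAt_xY1 {x : ℝ} (hx : 0 < x) : HasDerivAt xY1 (x * Y 0 x) x := by
  refine ((hasDerivAt_logSolDeriv (-1) hx).const_mul (2 / Real.pi)).neg.congr_deriv ?_
  rw [Y_zero_eq]; ring

theorem hasDerivAt_xK1 {x : ℝ} (hx : 0 < x) : HasDerivAt xK1 (-(x * K 0 x)) x := by
  refine (hasDerivAt_logSolDeriv 1 hx).congr_deriv ?_
  rw [K_zero_eq]; ring

theorem continuous_J_zero : Continuous (J 0) := by
  rw [J_zero_eq]; exact (expBounded_pow _).continuous_even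

theorem continuous_I_zero : Continuous (I 0) := by
  rw [I_zero_eq]; exact (expBounded_pow _).continuous_even

theorem continuous_J_one : Continuous (J 1) := by
  rw [J_one_eq]; exact (expBounded_pow _).continuous_odd

theorem continuous_I_one : Continuous (I 1) := by
  rw [I_one_eq]; exact (expBounded_pow _).continuous_odd

theorem continuous_mul_Y_zero : Continuous fun x => x * Y 0 x := by
  simp only [Y_zero_eq]
  have := (continuous_mul_logSol (-1)).const_mul (2 / Real.pi)
  exact this.congr fun x => by ring

theorem continuous_mul_K_zero : Continuous fun x => x * K 0 x := by
  simp only [K_zero_eq]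
  exact (continuous_mul_logSol 1).neg.congr fun x => (mul_neg _ _).symm

theorem continuous_xY1 : Continuous xY1 :=
  ((continuous_logSolDeriv (-1)).const_mul _).neg

theorem continuous_xK1 : Continuous xK1 := continuous_logSolDeriv 1

theorem J_zero_zero : J 0 0 = 1 := by rw [J_zero_eq, evenSeries_zero, pow_zero]

theorem I_zero_zero : I 0 0 = 1 := by rw [I_zero_eq, evenSeries_zero, pow_zero]

theorem J_one_zero : J 1 0 = 0 := by rw [J_one_eq, oddSeries_zero]

theorem I_one_zero : I 1 0 = 0 := by rw [I_one_eq, oddSeries_zero]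

theorem xY1_zero : xY1 0 = -(2 / Real.pi) := by rw [xY1, logSolDeriv_zero, mul_one]

theorem xK1_zero : xK1 0 = 1 := logSolDeriv_zero 1

theorem antitoneOn_Ici_of_hasDerivAt {f f' : ℝ → ℝ} (hc : Continuous f)
    (hd : ∀ x, 0 < x → HasDerivAt f (f' x) x) (hn : ∀ x, 0 < x → f' x ≤ 0) :
    AntitoneOn f (Set.Ici 0) := by
  refine antitoneOn_of_hasDerivWithinAt_nonpos (f' := f') (convex_Ici 0) hc.continuousOn ?_ ?_ <;>
    rw [interior_Ici]
  · exact fun x hx => (hd x hx).hasDerivWithinAt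
  · exact hn

theorem antitoneOn_Ioi_of_hasDerivAt {f f' : ℝ → ℝ}
    (hd : ∀ x, 0 < x → HasDerivAt f (f' x) x) (hn : ∀ x, 0 < x → f' x ≤ 0) :
    AntitoneOn f (Set.Ioi 0) := by
  refine antitoneOn_of_hasDerivWithinAt_nonpos (f' := f') (convex_Ioi 0)
    (fun x hx => (hd x hx).continuousAt.continuousWithinAt) ?_ ?_ <;> rw [interior_Ioi]
  · exact fun x hx => (hd x hx).hasDerivWithinAt
  · exact hn

/-! ### Bounds for the functions of the first kind -/

theorem J_sq_add_sq_le {x : ℝ} (hx : 0 ≤ x) : J 0 x ^ 2 + J 1 x ^ 2 ≤ 1 := by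
  have h := antitoneOn_Ici_of_hasDerivAt (f := J 0 ^ 2 + J 1 ^ 2)
    (f' := fun x => -(2 * J 1 x ^ 2 / x))
    ((continuous_J_zero.pow 2).add (continuous_J_one.pow 2))
    (fun y hy => by
      refine (((hasDerivAt_J_zero y).pow 2).add ((hasDerivAt_J_one hy.ne').pow 2)).congr_deriv ?_
      push_cast
      ring)
    (fun y hy => by rw [neg_nonpos]; positivity)
  have := h Set.self_mem_Ici hx hx
  simpa [J_zero_zero, J_one_zero] using this

theorem abs_J_zero_le {x : ℝ} (hx : 0 ≤ x) : |J 0 x| ≤ 1 := by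
  rw [← sq_le_one_iff_abs_le_one]
  nlinarith [J_sq_add_sq_le hx, sq_nonneg (J 1 x)]

theorem abs_J_one_le {x : ℝ} (hx : 0 ≤ x) : |J 1 x| ≤ 1 := by
  rw [← sq_le_one_iff_abs_le_one]
  nlinarith [J_sq_add_sq_le hx, sq_nonneg (J 0 x)]

/-- Integrating |(z J₁)'| = |z J₀| ≤ z gives |z J₁| ≤ z²/2. Linear vanishing at 0 later offsets the
logarithms of Y₀ K₀ and makes the integral small for small parameter. -/
theorem abs_J_one_le_self {x : ℝ} (hx : 0 ≤ x) : |J 1 x| ≤ x := by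
  rcases hx.eq_or_lt with rfl | hx'
  · simp [J_one_zero]
  have hd : ∀ y : ℝ, HasDerivAt (fun z : ℝ => z ^ 2 / 2) y y := fun y =>
    (((hasDerivAt_id y).pow 2).div_const 2).congr_deriv (by simp)
  have hc : Continuous fun z : ℝ => z * J 1 z := continuous_id.mul continuous_J_one
  have h1 := antitoneOn_Ici_of_hasDerivAt (f := (fun z => z * J 1 z) - fun z : ℝ => z ^ 2 / 2)
    (hc.sub (by fun_prop)) (fun y _ => (hasDerivAt_mul_J_one y).sub (hd y))
    (fun y hy => by nlinarith [(abs_le.1 (abs_J_zero_le hy.le)).2])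
  have h2 := antitoneOn_Ici_of_hasDerivAt (f := -(fun z => z * J 1 z) - fun z : ℝ => z ^ 2 / 2)
    (hc.neg.sub (by fun_prop)) (fun y _ => (hasDerivAt_mul_J_one y).neg.sub (hd y))
    (fun y hy => by nlinarith [(abs_le.1 (abs_J_zero_le hy.le)).1])
  have h3 := h1 Set.self_mem_Ici hx hx
  have h4 := h2 Set.self_mem_Ici hx hx
  simp only [Pi.sub_apply, Pi.neg_apply, zero_mul, neg_zero, ne_eq, OfNat.ofNat_ne_zero,
    not_false_eq_true, zero_pow, zero_div, sub_zero] at h3 h4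
  rw [abs_le]
  constructor
  · nlinarith
  · nlinarith

theorem one_le_I_zero (x : ℝ) : 1 ≤ I 0 x := by
  rw [I_zero_eq, evenSeries]
  have h := ((expBounded_pow 1).summable_even x).le_tsum 0 fun k _ => by
    rw [one_pow, pow_mul]; positivity
  simpa using h

theorem I_zero_pos (x : ℝ) : 0 < I 0 x := zero_lt_one.trans_le (one_le_I_zero x)

theorem half_le_I_one {x : ℝ} (hx : 0 ≤ x) : x / 2 ≤ I 1 x := by
  rw [I_one_eq, oddSeries]
  have h := ((expBounded_pow 1).summable_odd x).le_tsum 0 fun k _ => by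
    rw [one_pow]; positivity
  simpa using h

theorem I_one_nonneg {x : ℝ} (hx : 0 ≤ x) : 0 ≤ I 1 x :=
  (by positivity : 0 ≤ x / 2).trans (half_le_I_one hx)

theorem I_one_pos {x : ℝ} (hx : 0 < x) : 0 < I 1 x :=
  (by positivity : 0 < x / 2).trans_le (half_le_I_one hx.le)

theorem I_zero_add_I_one_le {x : ℝ} (hx : 0 ≤ x) : I 0 x + I 1 x ≤ Real.exp x := by
  have h := antitoneOn_Ici_of_hasDerivAt (f := fun z => Real.exp (-z) * (I 0 z + I 1 z))
    (f' := fun z => -(Real.exp (-z) * I 1 z / z))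
    ((Real.continuous_exp.comp continuous_neg).mul (continuous_I_zero.add continuous_I_one))
    (fun y hy => by
      refine ((hasDerivAt_id y).neg.exp.mul
        ((hasDerivAt_I_zero y).add (hasDerivAt_I_one hy.ne'))).congr_deriv ?_
      simp only [id, Pi.neg_apply, Pi.add_apply]
      ring)
    (fun y hy => by
      rw [neg_nonpos]
      exact div_nonneg (mul_nonneg (Real.exp_pos _).le (I_one_nonneg hy.le)) hy.le)
  have h1 := h Set.self_mem_Ici hx hx
  simp only [neg_zero, Real.exp_zero, I_zero_zero, I_one_zero, add_zero, mul_one,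
    Real.exp_neg] at h1
  rwa [inv_mul_le_iff₀ (Real.exp_pos x), mul_one] at h1

theorem I_zero_le_exp {x : ℝ} (hx : 0 ≤ x) : I 0 x ≤ Real.exp x := by
  linarith [I_zero_add_I_one_le hx, I_one_nonneg hx]

theorem I_one_le_exp {x : ℝ} (hx : 0 ≤ x) : I 1 x ≤ Real.exp x := by
  linarith [I_zero_add_I_one_le hx, I_zero_pos x]

theorem I_one_le_I_zero {x : ℝ} (hx : 0 ≤ x) : I 1 x ≤ I 0 x := by
  have h := antitoneOn_Ici_of_hasDerivAt (f := fun z => Real.exp z * (I 1 z - I 0 z))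
    (f' := fun z => -(Real.exp z * I 1 z / z))
    (Real.continuous_exp.mul (continuous_I_one.sub continuous_I_zero))
    (fun y hy => by
      refine ((Real.hasDerivAt_exp y).mul
        ((hasDerivAt_I_one hy.ne').sub (hasDerivAt_I_zero y))).congr_deriv ?_
      simp only [Pi.sub_apply]
      ring)
    (fun y hy => by
      rw [neg_nonpos]
      exact div_nonneg (mul_nonneg (Real.exp_pos _).le (I_one_nonneg hy.le)) hy.le)
  have h1 := h Set.self_mem_Ici hx hx
  simp only [Real.exp_zero, I_zero_zero, I_one_zero, one_mul, zero_sub] at h1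
  have h2 : Real.exp x * (I 1 x - I 0 x) ≤ 0 := by linarith
  by_contra! hlt
  exact absurd h2 (not_le.2 (mul_pos (Real.exp_pos x) (by linarith)))

/-! ### Bounds for the functions of the second kind -/

/-- The energy Y₀² + Y₁² has derivative -2Y₁²/x, as for J; it is compared with its value at 1
because Y is singular at 0. -/
theorem Y_sq_add_sq_le {x : ℝ} (hx : 1 ≤ x) :
    Y 0 x ^ 2 + (xY1 x / x) ^ 2 ≤ Y 0 1 ^ 2 + xY1 1 ^ 2 := by
  have h := antitoneOn_Ioi_of_hasDerivAt (f := Y 0 ^ 2 + (xY1 / id) ^ 2)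
    (f' := fun x => -(2 * (xY1 x / x) ^ 2 / x))
    (fun y hy => by
      refine (((hasDerivAt_Y_zero hy).pow 2).add
        (((hasDerivAt_xY1 hy).div (hasDerivAt_id y) hy.ne').pow 2)).congr_deriv ?_
      simp only [Pi.div_apply, id]
      push_cast
      field_simp
      ring)
    (fun y hy => by rw [neg_nonpos]; positivity)
  have := h (Set.mem_Ioi.2 one_pos) (Set.mem_Ioi.2 (one_pos.trans_le hx)) hx
  simpa using this

theorem exists_abs_Y_zero_le : ∃ C, 0 ≤ C ∧ ∀ x, 1 ≤ x → |Y 0 x| ≤ C ∧ |xY1 x| ≤ C * x := by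
  refine ⟨√(Y 0 1 ^ 2 + xY1 1 ^ 2), Real.sqrt_nonneg _, fun x hx => ?_⟩
  have h := Y_sq_add_sq_le hx
  have hx0 : 0 < x := one_pos.trans_le hx
  refine ⟨Real.abs_le_sqrt (by nlinarith [sq_nonneg (xY1 x / x)]), ?_⟩
  have h1 : |xY1 x / x| ≤ _ := Real.abs_le_sqrt (by nlinarith [sq_nonneg (Y 0 x)] :
    (xY1 x / x) ^ 2 ≤ Y 0 1 ^ 2 + xY1 1 ^ 2)
  rwa [abs_div, abs_of_pos hx0, div_le_iff₀ hx0] at h1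

/-- K₀ is the even series with coefficients ψ(k+1) - log(x/2), which is close to log t for t =
(k+1)/(x/2). The bounds 1 - 1/t ≤ log t ≤ t - 1 replace these coefficients by ones whose series are
combinations of I₀ and I₁. Crude as it is, the result forces K₀/I₀ → 0. -/
theorem abs_K_zero_le {x : ℝ} (hx : 0 < x) : |K 0 x| ≤ 2 / x * I 0 x := by
  have hs : 0 < x / 2 := by positivity
  have hI0 : evenSeries (fun _ => 1) x = I 0 x := by rw [I_zero_eq]; simp only [one_pow]
  have hI1 : oddSeries (fun _ => 1) x = I 1 x := by rw [I_one_eq]; simp only [one_pow]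
  have hle := I_one_le_I_zero hx.le
  have hb := expBounded_psiSucc
  have hinv : evenSeries (fun k => 1 / ((k : ℝ) + 1)) x = 2 / x * I 1 x := by
    have := oddSeries_eq (fun _ => 1) x
    simp only [one_mul] at this
    rw [← hI1, this]
    field_simp
  have hK : K 0 x = evenSeries psiSucc x + -Real.log (x / 2) * I 0 x := by
    rw [K_zero_eq, logSol, I_zero_eq]
    simp only [one_pow, one_mul]
    ring
  have hK' : K 0 x = evenSeries (fun k => psiSucc k + -Real.log (x / 2)) x := by
    rw [hK, hb.evenSeries_add (expBounded_const _), ← hI0, ← evenSeries_const_mul]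
    simp only [mul_one]
  have hup : K 0 x ≤ 2 / x * I 0 x := by
    calc K 0 x ≤ evenSeries (fun k => 2 / x * (k : ℝ) + (2 / x - 1) * 1) x := by
          rw [hK']
          refine (hb.add (expBounded_const _)).evenSeries_mono ?_ (fun k => ?_) x
          · exact ((expBounded_const _).mul expBounded_natCast).add
              ((expBounded_const _).mul expBounded_one)
          have h1 := psiSucc_lt_log k
          have h2 := Real.log_le_sub_one_of_pos (x := ((k : ℝ) + 1) / (x / 2)) (by positivity)
          rw [Real.log_div (by positivity) hs.ne'] at h2
          have h3 : ((k : ℝ) + 1) / (x / 2) = 2 / x * k + 2 / x := by field_simp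
          linarith
      _ = I 1 x + (2 / x - 1) * I 0 x := by
          rw [((expBounded_const _).mul expBounded_natCast).evenSeries_add
            ((expBounded_const _).mul expBounded_one), evenSeries_const_mul,
            evenSeries_const_mul, hI0, evenSeries_natCast, hI1]
          field_simp
      _ ≤ 2 / x * I 0 x := by linarith
  have hlo : -(2 / x * I 0 x) ≤ K 0 x := by
    calc -(2 / x * I 0 x) ≤ I 0 x - I 1 x - 2 / x * I 1 x := by
          have : 2 / x * I 1 x ≤ 2 / x * I 0 x := by gcongr
          linarith
      _ = evenSeries (fun k => 1 + -(x / 2 + 1) * (1 / ((k : ℝ) + 1))) x := by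
          rw [expBounded_one.evenSeries_add ((expBounded_const _).mul expBounded_inv_succ),
            evenSeries_const_mul, hI0, hinv]
          field_simp
          ring
      _ ≤ K 0 x := by
          rw [hK']
          refine (expBounded_one.add ((expBounded_const _).mul expBounded_inv_succ)).evenSeries_mono
            (hb.add (expBounded_const _)) (fun k => ?_) x
          have h1 := log_sub_lt_psiSucc k
          have h2 := Real.one_sub_inv_le_log_of_pos (x := ((k : ℝ) + 1) / (x / 2)) (by positivity)
          rw [Real.log_div (by positivity) hs.ne', inv_div] at h2
          have h3 : (x / 2 + 1) * (1 / ((k : ℝ) + 1)) = x / 2 / (k + 1) + 1 / ((k : ℝ) + 1) := by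
            ring
          linarith
  exact abs_le.2 ⟨hlo, hup⟩

theorem wronskian_I_K {x : ℝ} (hx : 0 ≤ x) : x * K 0 x * I 1 x + xK1 x * I 0 x = 1 := by
  have hc : Continuous fun z => z * K 0 z * I 1 z + xK1 z * I 0 z :=
    (continuous_mul_K_zero.mul continuous_I_one).add (continuous_xK1.mul continuous_I_zero)
  have hd : ∀ y, 0 < y → HasDerivAt (fun z => z * K 0 z * I 1 z + xK1 z * I 0 z) 0 y := by
    intro y hy
    have h : (fun z => z * K 0 z * I 1 z + xK1 z * I 0 z)
        = K 0 * (fun z => z * I 1 z) + xK1 * I 0 := by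
      funext z; simp only [Pi.add_apply, Pi.mul_apply]; ring
    rw [h]
    refine (((hasDerivAt_K_zero hy).mul (hasDerivAt_mul_I_one y)).add
      ((hasDerivAt_xK1 hy).mul (hasDerivAt_I_zero y))).congr_deriv ?_
    field_simp
    ring
  have h1 := antitoneOn_Ici_of_hasDerivAt hc hd (fun _ _ => le_rfl) Set.self_mem_Ici hx hx
  have h2 := antitoneOn_Ici_of_hasDerivAt hc.neg (fun y hy => (hd y hy).neg)
    (fun _ _ => by simp) Set.self_mem_Ici hx hx
  simp only [Pi.neg_apply, zero_mul, xK1_zero, I_zero_zero, zero_add, mul_one] at h1 h2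
  linarith

/-- An antitone function on `(0, ∞)` that tends to zero is nonnegative. -/
theorem nonneg_of_antitoneOn {f : ℝ → ℝ} (h : AntitoneOn f (Set.Ioi 0))
    (h0 : Tendsto f atTop (𝓝 0)) {x : ℝ} (hx : 0 < x) : 0 ≤ f x := by
  refine le_of_tendsto h0 ?_
  filter_upwards [eventually_ge_atTop x] with y hy
  exact h (Set.mem_Ioi.2 hx) (Set.mem_Ioi.2 (hx.trans_le hy)) hy

theorem tendsto_K_div_I : Tendsto (fun x => K 0 x / I 0 x) atTop (𝓝 0) := by
  refine squeeze_zero_norm' (a := fun x : ℝ => 2 / x) ?_ (tendsto_const_nhds.div_atTop tendsto_id)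
  filter_upwards [eventually_gt_atTop 0] with x hx
  rw [Real.norm_eq_abs, abs_div, abs_of_pos (I_zero_pos x), div_le_iff₀ (I_zero_pos x)]
  exact abs_K_zero_le hx

/-- By the Wronskian, K₀/I₀ has derivative -1/(x I₀²), so it decreases to its limit 0. -/
theorem K_zero_nonneg {x : ℝ} (hx : 0 < x) : 0 ≤ K 0 x := by
  have h := antitoneOn_Ioi_of_hasDerivAt (f := fun x => K 0 x / I 0 x)
    (f' := fun x => -(1 / (x * I 0 x ^ 2)))
    (fun y hy => by
      refine ((hasDerivAt_K_zero hy).div (hasDerivAt_I_zero y) (I_zero_pos y).ne').congr_deriv ?_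
      have := (I_zero_pos y).ne'
      rw [← wronskian_I_K hy.le]
      field_simp
      ring)
    (fun y hy => by rw [neg_nonpos]; positivity)
  have := nonneg_of_antitoneOn h tendsto_K_div_I hx
  rwa [le_div_iff₀ (I_zero_pos x), zero_mul] at this

/-- K₁/I₁ is decreasing by the Wronskian, which also writes it as 1/(x I₀ I₁) - K₀/I₀; both terms
tend to 0. -/
theorem xK1_nonneg {x : ℝ} (hx : 0 < x) : 0 ≤ xK1 x := by
  have h := antitoneOn_Ioi_of_hasDerivAt (f := fun x => xK1 x / (x * I 1 x))
    (f' := fun x => -(x / (x * I 1 x) ^ 2))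
    (fun y hy => by
      have h1 := (I_one_pos hy).ne'
      refine ((hasDerivAt_xK1 hy).div (hasDerivAt_mul_I_one y)
        (mul_ne_zero hy.ne' h1)).congr_deriv ?_
      rw [← neg_div, ← mul_one (-y), ← wronskian_I_K hy.le]
      congr 1
      ring)
    (fun y hy => by rw [neg_nonpos]; positivity)
  have h0 : Tendsto (fun x => xK1 x / (x * I 1 x)) atTop (𝓝 0) := by
    have h1 : Tendsto (fun x => 1 / (I 0 x * (x * I 1 x))) atTop (𝓝 0) := by
      refine squeeze_zero_norm' (a := fun x : ℝ => 2 / x)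
        ?_ (tendsto_const_nhds.div_atTop tendsto_id)
      filter_upwards [eventually_ge_atTop 1] with x hx
      have hx0 : 0 < x := one_pos.trans_le hx
      have hI := half_le_I_one hx0.le
      have hI' := one_le_I_zero x
      rw [Real.norm_of_nonneg (by have := I_one_pos hx0; have := I_zero_pos x; positivity),
        ← one_div_div x 2]
      refine one_div_le_one_div_of_le (by positivity) ?_
      calc x / 2 = 1 * (1 * (x / 2)) := by ring
        _ ≤ I 0 x * (x * I 1 x) := by gcongr
    refine (h1.sub tendsto_K_div_I).congr' ?_ |>.trans (by simp)
    filter_upwards [eventually_gt_atTop 0] with y hy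
    have h2 := (I_one_pos hy).ne'
    have h3 := (I_zero_pos y).ne'
    rw [← wronskian_I_K hy.le]
    field_simp
    ring
  have := nonneg_of_antitoneOn h h0 hx
  rwa [le_div_iff₀ (mul_pos hx (I_one_pos hx)), zero_mul] at this

/-- The quantity eˣ(K₀ + K₁) has derivative -eˣ K₁/x ≤ 0, and nonnegativity of both summands lets
each be bounded separately. -/
theorem exists_K_zero_le : ∃ C, 0 ≤ C ∧
    ∀ x, 1 ≤ x → |K 0 x| ≤ C * Real.exp (-x) ∧ |xK1 x| ≤ C * x * Real.exp (-x) := by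
  have h := antitoneOn_Ioi_of_hasDerivAt (f := fun z => Real.exp z * (K 0 z + xK1 z / z))
    (f' := fun z => -(Real.exp z * (xK1 z / z ^ 2)))
    (fun y hy => by
      refine ((Real.hasDerivAt_exp y).mul ((hasDerivAt_K_zero hy).add
        ((hasDerivAt_xK1 hy).div (hasDerivAt_id y) hy.ne'))).congr_deriv ?_
      simp only [Pi.add_apply, Pi.div_apply, id]
      field_simp
      ring)
    (fun y hy => by
      have := xK1_nonneg hy
      rw [neg_nonpos]; positivity)
  have hpos : ∀ x, 0 < x → 0 ≤ Real.exp x * (K 0 x + xK1 x / x) := fun x hx => by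
    have := xK1_nonneg hx
    have := K_zero_nonneg hx
    positivity
  refine ⟨_, hpos 1 one_pos, fun x hx => ?_⟩
  have hx0 : 0 < x := one_pos.trans_le hx
  have h1 := h (Set.mem_Ioi.2 one_pos) (Set.mem_Ioi.2 hx0) hx
  have hk := xK1_nonneg hx0
  have hK := K_zero_nonneg hx0
  beta_reduce at h1
  set C := Real.exp 1 * (K 0 1 + xK1 1 / 1)
  have h2 : K 0 x + xK1 x / x ≤ C * Real.exp (-x) := by
    rw [Real.exp_neg, ← div_eq_mul_inv, le_div_iff₀ (Real.exp_pos x), mul_comm]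
    exact h1
  have h3 : 0 ≤ xK1 x / x := by positivity
  refine ⟨by rw [abs_of_nonneg hK]; linarith, ?_⟩
  rw [abs_of_nonneg hk]
  have h4 : xK1 x / x ≤ C * Real.exp (-x) := by linarith
  rw [div_le_iff₀ hx0] at h4
  linarith

/-! ### The Lommel-type integral -/

/-- The product is of order x² e^(-(1-c)x); half of the exponential rate is spent on absorbing x².
-/
theorem isBigO_mul_mul {c : ℝ} (hc : c < 1) {f g h : ℝ → ℝ}
    (hf : ∃ C, ∀ x, 1 ≤ x → |f x| ≤ C * x)
    (hg : ∃ C, ∀ x, 1 ≤ x → |g x| ≤ C * x * Real.exp (-x))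
    (hh : ∃ C, ∀ x, 1 ≤ x → |h x| ≤ C * Real.exp (c * x)) :
    (fun x => h x * (f x * g x)) =O[atTop] fun x => Real.exp (-((1 - c) / 2) * x) := by
  obtain ⟨C, hf⟩ := hf
  obtain ⟨D, hg⟩ := hg
  obtain ⟨E, hh⟩ := hh
  have h1 : (fun x => h x * (f x * g x)) =O[atTop]
      fun x => x ^ 2 * Real.exp (-(1 - c) * x) := by
    refine Asymptotics.IsBigO.of_bound (E * (C * D)) ?_
    filter_upwards [eventually_ge_atTop 1] with x hx
    have hx0 : 0 < x := one_pos.trans_le hx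
    have he : Real.exp (-(1 - c) * x) = Real.exp (c * x) * Real.exp (-x) := by
      rw [← Real.exp_add]; ring_nf
    rw [Real.norm_eq_abs, Real.norm_of_nonneg (by positivity), abs_mul, abs_mul, he]
    calc |h x| * (|f x| * |g x|)
        ≤ (E * Real.exp (c * x)) * ((C * x) * (D * x * Real.exp (-x))) := by
          refine mul_le_mul (hh x hx) (mul_le_mul (hf x hx) (hg x hx) (abs_nonneg _)
            ((abs_nonneg _).trans (hf x hx))) (by positivity) ((abs_nonneg _).trans (hh x hx))
      _ = _ := by ring
  have h2 : (fun x : ℝ => x ^ 2 * Real.exp (-(1 - c) * x)) =O[atTop]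
      fun x => Real.exp ((1 - c) / 2 * x) * Real.exp (-(1 - c) * x) :=
    (isLittleO_pow_exp_pos_mul_atTop 2 (by linarith)).isBigO.mul (Asymptotics.isBigO_refl _ _)
  refine (h1.trans h2).congr_right fun x => ?_
  rw [← Real.exp_add]
  ring_nf

theorem tendsto_mul_mul {c : ℝ} (hc : c < 1) {f g h : ℝ → ℝ}
    (hf : ∃ C, ∀ x, 1 ≤ x → |f x| ≤ C * x)
    (hg : ∃ C, ∀ x, 1 ≤ x → |g x| ≤ C * x * Real.exp (-x))
    (hh : ∃ C, ∀ x, 1 ≤ x → |h x| ≤ C * Real.exp (c * x)) :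
    Tendsto (fun x => h x * (f x * g x)) atTop (𝓝 0) := by
  refine (isBigO_mul_mul hc hf hg hh).trans_tendsto ?_
  refine Real.tendsto_exp_atBot.comp ?_
  exact tendsto_id.const_mul_atTop_of_neg (by linarith)

theorem integrableOn_mul_mul {c : ℝ} (hc : c < 1) {f g h : ℝ → ℝ}
    (hfc : Continuous f) (hgc : Continuous g) (hhc : Continuous h)
    (hf : ∃ C, ∀ x, 1 ≤ x → |f x| ≤ C * x)
    (hg : ∃ C, ∀ x, 1 ≤ x → |g x| ≤ C * x * Real.exp (-x))
    (hh : ∃ C, ∀ x, 1 ≤ x → |h x| ≤ C * Real.exp (c * x)) :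
    IntegrableOn (fun x => h x * (f x * g x)) (Set.Ioi 0) :=
  integrable_of_isBigO_exp_neg (by linarith : 0 < (1 - c) / 2)
    (hhc.mul (hfc.mul hgc)).continuousOn (isBigO_mul_mul hc hf hg hh)

theorem exists_abs_mul_Y_zero_le : ∃ C, ∀ x, 1 ≤ x → |x * Y 0 x| ≤ C * x := by
  obtain ⟨C, -, h⟩ := exists_abs_Y_zero_le
  refine ⟨C, fun x hx => ?_⟩
  rw [abs_mul, abs_of_nonneg (by linarith), mul_comm]
  exact mul_le_mul_of_nonneg_right (h x hx).1 (by linarith)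

theorem exists_abs_xY1_le : ∃ C, ∀ x, 1 ≤ x → |xY1 x| ≤ C * x := by
  obtain ⟨C, -, h⟩ := exists_abs_Y_zero_le
  exact ⟨C, fun x hx => (h x hx).2⟩

theorem exists_abs_mul_K_zero_le : ∃ C, ∀ x, 1 ≤ x → |x * K 0 x| ≤ C * x * Real.exp (-x) := by
  obtain ⟨C, -, h⟩ := exists_K_zero_le
  refine ⟨C, fun x hx => ?_⟩
  rw [abs_mul, abs_of_nonneg (by linarith : 0 ≤ x), mul_comm C, mul_assoc]
  exact mul_le_mul_of_nonneg_left (h x hx).1 (by linarith)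

theorem exists_abs_xK1_le : ∃ C, ∀ x, 1 ≤ x → |xK1 x| ≤ C * x * Real.exp (-x) := by
  obtain ⟨C, -, h⟩ := exists_K_zero_le
  exact ⟨C, fun x hx => (h x hx).2⟩

theorem abs_J_mul_I_le (p q : ℝ) {x : ℝ} (hx : 0 ≤ x) :
    |p * (J 0 x * I 1 x) + q * (J 1 x * I 0 x)| ≤ (|p| + |q|) * Real.exp x := by
  have h1 : |J 0 x * I 1 x| ≤ Real.exp x := by
    rw [abs_mul, abs_of_nonneg (I_one_nonneg hx), ← one_mul (Real.exp x)]
    exact mul_le_mul (abs_J_zero_le hx) (I_one_le_exp hx) (I_one_nonneg hx) zero_le_one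
  have h2 : |J 1 x * I 0 x| ≤ Real.exp x := by
    rw [abs_mul, abs_of_pos (I_zero_pos x), ← one_mul (Real.exp x)]
    exact mul_le_mul (abs_J_one_le hx) (I_zero_le_exp hx) (I_zero_pos x).le zero_le_one
  refine (abs_add_le _ _).trans ?_
  rw [abs_mul p, abs_mul q, add_mul]
  gcongr

theorem abs_J_zero_mul_I_zero_le {x : ℝ} (hx : 0 ≤ x) : |J 0 x * I 0 x| ≤ Real.exp x := by
  rw [abs_mul, abs_of_pos (I_zero_pos x), ← one_mul (Real.exp x)]
  exact mul_le_mul (abs_J_zero_le hx) (I_zero_le_exp hx) (I_zero_pos x).le zero_le_one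

theorem abs_J_one_mul_I_one_le {x : ℝ} (hx : 0 ≤ x) : |J 1 x * I 1 x| ≤ Real.exp x := by
  rw [abs_mul, abs_of_nonneg (I_one_nonneg hx), ← one_mul (Real.exp x)]
  exact mul_le_mul (abs_J_one_le hx) (I_one_le_exp hx) (I_one_nonneg hx) zero_le_one

/-- The bilinear concomitant whose derivative is a multiple of
`x² (J₀ I₁ + J₁ I₀)(a x) Y₀(x) K₀(x)`. -/
noncomputable def concomitant (a x : ℝ) : ℝ :=
  ((2 / a - 2 * a) * (J 0 (a * x) * I 1 (a * x)) + (2 / a + 2 * a) * (J 1 (a * x) * I 0 (a * x)))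
      * (x * Y 0 x * xK1 x)
    + ((-2 / a - 2 * a) * (J 0 (a * x) * I 1 (a * x))
        + (-2 / a + 2 * a) * (J 1 (a * x) * I 0 (a * x))) * (xY1 x * (x * K 0 x))
    + -4 * (J 0 (a * x) * I 0 (a * x)) * (xY1 x * xK1 x)
    + 4 * a ^ 2 * (J 1 (a * x) * I 1 (a * x)) * (x * Y 0 x * (x * K 0 x))

theorem continuous_concomitant (a : ℝ) : Continuous (concomitant a) := by
  have hm : Continuous fun x : ℝ => a * x := continuous_const.mul continuous_id
  have h1 := continuous_J_zero.comp hm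
  have h2 := continuous_J_one.comp hm
  have h3 := continuous_I_zero.comp hm
  have h4 := continuous_I_one.comp hm
  have h5 := continuous_mul_Y_zero
  have h6 := continuous_mul_K_zero
  have h7 := continuous_xY1
  have h8 := continuous_xK1
  exact ((((((h1.mul h4).const_mul _).add ((h2.mul h3).const_mul _)).mul (h5.mul h8)).add
    ((((h1.mul h4).const_mul _).add ((h2.mul h3).const_mul _)).mul (h7.mul h6))).add
    (((h1.mul h3).const_mul _).mul (h7.mul h8))).add (((h2.mul h4).const_mul _).mul (h5.mul h6))

/-- Only the J₀ I₀ term survives, contributing -4 · (-2/π) · 1. -/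
theorem concomitant_zero (a : ℝ) : concomitant a 0 = 8 / Real.pi := by
  simp only [concomitant, mul_zero, zero_mul, J_zero_zero, I_zero_zero, J_one_zero, I_one_zero,
    xY1_zero, xK1_zero]
  ring

theorem tendsto_concomitant {a : ℝ} (ha0 : 0 < a) (ha1 : a < 1) :
    Tendsto (concomitant a) atTop (𝓝 0) := by
  have hx : ∀ x : ℝ, 1 ≤ x → 0 ≤ a * x := fun x hx => by positivity
  have h1 := tendsto_mul_mul ha1 exists_abs_mul_Y_zero_le exists_abs_xK1_le
    ⟨_, fun x h => abs_J_mul_I_le (2 / a - 2 * a) (2 / a + 2 * a) (hx x h)⟩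
  have h2 := tendsto_mul_mul ha1 exists_abs_xY1_le exists_abs_mul_K_zero_le
    ⟨_, fun x h => abs_J_mul_I_le (-2 / a - 2 * a) (-2 / a + 2 * a) (hx x h)⟩
  have h3 := tendsto_mul_mul ha1 exists_abs_xY1_le exists_abs_xK1_le
    (h := fun x => -4 * (J 0 (a * x) * I 0 (a * x))) ⟨4, fun x h => by
      rw [abs_mul, abs_neg, abs_of_pos (by norm_num : (0 : ℝ) < 4)]
      exact mul_le_mul_of_nonneg_left (abs_J_zero_mul_I_zero_le (hx x h)) (by norm_num)⟩
  have h4 := tendsto_mul_mul ha1 exists_abs_mul_Y_zero_le exists_abs_mul_K_zero_le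
    (h := fun x => 4 * a ^ 2 * (J 1 (a * x) * I 1 (a * x))) ⟨4 * a ^ 2, fun x h => by
      rw [abs_mul, abs_of_pos (by positivity : (0 : ℝ) < 4 * a ^ 2)]
      exact mul_le_mul_of_nonneg_left (abs_J_one_mul_I_one_le (hx x h)) (by positivity)⟩
  have h := ((h1.add h2).add h3).add h4
  simp only [add_zero] at h
  exact h

theorem hasDerivAt_concomitant {a x : ℝ} (ha : 0 < a) (hx : 0 < x) :
    HasDerivAt (concomitant a) (-4 * (1 - a ^ 4) / a *
      ((J 0 (a * x) * I 1 (a * x) + J 1 (a * x) * I 0 (a * x)) * (x * Y 0 x * (x * K 0 x)))) x := by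
  have hm : HasDerivAt (fun y : ℝ => a * y) a x := by
    simpa using (hasDerivAt_id x).const_mul a
  have hA : HasDerivAt (fun y => J 0 (a * y)) (-J 1 (a * x) * a) x :=
    (hasDerivAt_J_zero (a * x)).comp x hm
  have hC : HasDerivAt (fun y => I 0 (a * y)) (I 1 (a * x) * a) x :=
    (hasDerivAt_I_zero (a * x)).comp x hm
  have hα : HasDerivAt (fun y => a * y * J 1 (a * y)) (a * x * J 0 (a * x) * a) x :=
    (hasDerivAt_mul_J_one (a * x)).comp x hm
  have hβ : HasDerivAt (fun y => a * y * I 1 (a * y)) (a * x * I 0 (a * x) * a) x :=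
    (hasDerivAt_mul_I_one (a * x)).comp x hm
  have hY := hasDerivAt_Y_zero hx
  have hK := hasDerivAt_K_zero hx
  have hy := hasDerivAt_xY1 hx
  have hk := hasDerivAt_xK1 hx
  -- The concomitant is regrouped by the 2/a part, the J₀ I₀ term, the 2a part and the J₁ I₁ term,
  -- with ax J₁ and ax I₁ as factors because their derivatives are single products.
  have h1 := (((hA.mul hβ).add (hα.mul hC)).mul ((hY.mul hk).sub (hy.mul hK))).const_mul (2 / a ^ 2)
  have h2 := ((hA.mul hC).mul (hy.mul hk)).const_mul 4
  have h3 := (((hA.mul hβ).sub (hα.mul hC)).mul ((hy.mul hK).add (hY.mul hk))).const_mul 2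
  have h4 := ((hα.mul hβ).mul (hY.mul hK)).const_mul 4
  refine ((((h1.sub h2).sub h3).add h4).congr_of_eventuallyEq
    (Eventually.of_forall fun y => ?_)).congr_deriv ?_
  · simp only [concomitant, Pi.add_apply, Pi.sub_apply, Pi.mul_apply]
    field_simp
    ring
  · simp only [Pi.add_apply, Pi.sub_apply, Pi.mul_apply]
    field_simp
    ring

theorem continuous_J_mul_I (a : ℝ) : Continuous fun x =>
    J 0 (a * x) * I 1 (a * x) + J 1 (a * x) * I 0 (a * x) := by
  have hm : Continuous fun x : ℝ => a * x := continuous_const.mul continuous_id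
  exact ((continuous_J_zero.comp hm).mul (continuous_I_one.comp hm)).add
    ((continuous_J_one.comp hm).mul (continuous_I_zero.comp hm))

theorem abs_J_mul_I_add_le {x : ℝ} (hx : 0 ≤ x) :
    |J 0 x * I 1 x + J 1 x * I 0 x| ≤ 2 * Real.exp x := by
  have h := abs_J_mul_I_le 1 1 hx
  simpa only [one_mul, abs_one, one_add_one_eq_two] using h

theorem integrableOn_J_mul_I_mul_Y_mul_K {a : ℝ} (ha0 : 0 < a) (ha1 : a < 1) :
    IntegrableOn (fun x => (J 0 (a * x) * I 1 (a * x) + J 1 (a * x) * I 0 (a * x)) *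
      (x * Y 0 x * (x * K 0 x))) (Set.Ioi 0) :=
  integrableOn_mul_mul ha1 continuous_mul_Y_zero continuous_mul_K_zero (continuous_J_mul_I a)
    exists_abs_mul_Y_zero_le exists_abs_mul_K_zero_le
    ⟨2, fun x hx => abs_J_mul_I_add_le (by positivity)⟩

theorem integral_J_mul_I_mul_Y_mul_K {a : ℝ} (ha0 : 0 < a) (ha1 : a < 1) :
    ∫ x in Set.Ioi (0 : ℝ), (J 0 (a * x) * I 1 (a * x) + J 1 (a * x) * I 0 (a * x)) *
      (x * Y 0 x * (x * K 0 x)) = 2 * a / (Real.pi * (1 - a ^ 4)) := by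
  have h := integral_Ioi_of_hasDerivAt_of_tendsto
    (continuous_concomitant a).continuousAt.continuousWithinAt
    (fun x hx => hasDerivAt_concomitant ha0 hx)
    ((integrableOn_J_mul_I_mul_Y_mul_K ha0 ha1).const_mul _) (tendsto_concomitant ha0 ha1)
  rw [integral_const_mul, concomitant_zero] at h
  have h4 : 0 < 1 - a ^ 4 := sub_pos.2 (pow_lt_one₀ ha0.le ha1 (by norm_num))
  have hpi := Real.pi_pos
  rw [eq_div_iff (by positivity)]
  generalize (∫ x in Set.Ioi (0 : ℝ), (J 0 (a * x) * I 1 (a * x) + J 1 (a * x) * I 0 (a * x)) *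
      (x * Y 0 x * (x * K 0 x))) = T at h ⊢
  field_simp at h
  linarith

/-! ### Integration with respect to the parameter -/

/-- The exponentially weighted product `e^(c x) (x Y₀) (x K₀)` dominates all the integrands. -/
theorem integrableOn_exp_mul_Y_mul_K {c : ℝ} (hc : c < 1) :
    IntegrableOn (fun x => Real.exp (c * x) * (x * Y 0 x * (x * K 0 x))) (Set.Ioi 0) :=
  integrableOn_mul_mul hc continuous_mul_Y_zero continuous_mul_K_zero (by fun_prop)
    exists_abs_mul_Y_zero_le exists_abs_mul_K_zero_le
    ⟨1, fun x _ => by rw [one_mul, Real.abs_exp]⟩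

/-- The bound |J₁(bx)| ≤ bx supplies the second x, so that Y₀ and K₀ appear only as x Y₀ and x K₀,
which are continuous at 0. -/
theorem abs_integrand_le {b x : ℝ} (hb : 0 ≤ b) (hx : 0 < x) :
    |x * J 1 (b * x) * I 1 (b * x) * Y 0 x * K 0 x|
      ≤ b * ‖Real.exp (b * x) * (x * Y 0 x * (x * K 0 x))‖ := by
  have hbx : 0 ≤ b * x := by positivity
  have h1 := abs_J_one_le_self hbx
  have h2 := I_one_le_exp hbx
  have h3 := I_one_nonneg hbx
  simp only [abs_mul, Real.norm_eq_abs, abs_of_pos hx, Real.abs_exp, abs_of_nonneg h3]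
  calc x * |J 1 (b * x)| * I 1 (b * x) * |Y 0 x| * |K 0 x|
      ≤ x * (b * x) * Real.exp (b * x) * |Y 0 x| * |K 0 x| := by gcongr
    _ = _ := by ring

theorem continuousOn_integrand (b : ℝ) : ContinuousOn
    (fun x => x * J 1 (b * x) * I 1 (b * x) * Y 0 x * K 0 x) (Set.Ioi 0) := by
  have hm : Continuous fun x : ℝ => b * x := continuous_const.mul continuous_id
  refine ContinuousOn.mul (ContinuousOn.mul (Continuous.continuousOn ?_) ?_) ?_
  · exact (continuous_id.mul (continuous_J_one.comp hm)).mul (continuous_I_one.comp hm)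
  · exact fun x hx => (hasDerivAt_Y_zero hx).continuousAt.continuousWithinAt
  · exact fun x hx => (hasDerivAt_K_zero hx).continuousAt.continuousWithinAt

theorem integrableOn_integrand {b : ℝ} (hb0 : 0 ≤ b) (hb1 : b < 1) : IntegrableOn
    (fun x => x * J 1 (b * x) * I 1 (b * x) * Y 0 x * K 0 x) (Set.Ioi 0) := by
  refine Integrable.mono' ((integrableOn_exp_mul_Y_mul_K hb1).norm.const_mul b)
    ((continuousOn_integrand b).aestronglyMeasurable measurableSet_Ioi) ?_
  filter_upwards [ae_restrict_mem measurableSet_Ioi] with x hx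
  exact abs_integrand_le hb0 hx

/-- The integral of the theorem, multiplied by `b²`. -/
noncomputable def scaledIntegral (b : ℝ) : ℝ :=
  ∫ x in Set.Ioi (0 : ℝ), b ^ 2 * (x * J 1 (b * x) * I 1 (b * x) * Y 0 x * K 0 x)

theorem hasDerivAt_scaledIntegrand {b x : ℝ} (hb : 0 < b) (hx : 0 < x) :
    HasDerivAt (fun b => b ^ 2 * (x * J 1 (b * x) * I 1 (b * x) * Y 0 x * K 0 x))
      (b ^ 2 * ((J 0 (b * x) * I 1 (b * x) + J 1 (b * x) * I 0 (b * x)) *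
        (x * Y 0 x * (x * K 0 x)))) b := by
  have hm : HasDerivAt (fun c : ℝ => c * x) x b := by
    simpa using (hasDerivAt_id b).mul_const x
  have hα : HasDerivAt (fun c => c * x * J 1 (c * x)) (b * x * J 0 (b * x) * x) b :=
    HasDerivAt.comp (h₂ := fun z => z * J 1 z) b (hasDerivAt_mul_J_one (b * x)) hm
  have hβ : HasDerivAt (fun c => c * x * I 1 (c * x)) (b * x * I 0 (b * x) * x) b :=
    HasDerivAt.comp (h₂ := fun z => z * I 1 z) b (hasDerivAt_mul_I_one (b * x)) hm
  -- With the factor b², the integrand is (bx J₁)(bx I₁) times Y₀ K₀/x, and only the first two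
  -- factors depend on b.
  refine (((hα.mul hβ).mul_const (Y 0 x * K 0 x / x)).congr_of_eventuallyEq
    (Eventually.of_forall fun c => ?_)).congr_deriv ?_
  · simp only [Pi.mul_apply]
    field_simp
  · field_simp

theorem hasDerivAt_scaledIntegral {b : ℝ} (hb0 : 0 < b) (hb1 : b < 1) :
    HasDerivAt scaledIntegral (2 * b ^ 3 / (Real.pi * (1 - b ^ 4))) b := by
  -- For parameters in (0, c), the weight e^(cx) with c < 1 dominates uniformly and stays integrable
  -- against x Y₀ · x K₀.
  obtain ⟨c, hbc, hc1⟩ := exists_between hb1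
  have h := hasDerivAt_integral_of_dominated_loc_of_deriv_le (μ := volume.restrict (Set.Ioi 0))
    (F := fun b x => b ^ 2 * (x * J 1 (b * x) * I 1 (b * x) * Y 0 x * K 0 x))
    (F' := fun b x => b ^ 2 * ((J 0 (b * x) * I 1 (b * x) + J 1 (b * x) * I 0 (b * x)) *
        (x * Y 0 x * (x * K 0 x))))
    (bound := fun x => 2 * ‖Real.exp (c * x) * (x * Y 0 x * (x * K 0 x))‖)
    (Ioo_mem_nhds hb0 hbc)
    (Eventually.of_forall fun d =>
      ((continuousOn_integrand d).const_mul _).aestronglyMeasurable measurableSet_Ioi)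
    ((integrableOn_integrand hb0.le hb1).const_mul _)
    ((integrableOn_J_mul_I_mul_Y_mul_K hb0 hb1).const_mul _).aestronglyMeasurable
    ?_ ((integrableOn_exp_mul_Y_mul_K hc1).norm.const_mul 2) ?_
  · refine h.2.congr_deriv ?_
    rw [integral_const_mul, integral_J_mul_I_mul_Y_mul_K hb0 hb1]
    ring
  · filter_upwards [ae_restrict_mem measurableSet_Ioi] with x hx d hd
    have hx0 : 0 < x := hx
    have hdx : 0 ≤ d * x := mul_nonneg hd.1.le hx0.le
    rw [norm_mul, norm_mul (J 0 (d * x) * I 1 (d * x) + _), norm_mul (Real.exp (c * x)),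
      ← mul_assoc (‖d ^ 2‖), ← mul_assoc (2 : ℝ)]
    refine mul_le_mul_of_nonneg_right ?_ (norm_nonneg (x * Y 0 x * (x * K 0 x)))
    have h1 : ‖d ^ 2‖ ≤ 1 := by
      rw [Real.norm_of_nonneg (by positivity)]
      exact pow_le_one₀ hd.1.le (hd.2.le.trans hc1.le)
    have h2 : 2 * Real.exp (d * x) ≤ 2 * ‖Real.exp (c * x)‖ := by
      rw [Real.norm_of_nonneg (Real.exp_pos _).le]
      have := hd.2.le
      gcongr
    rw [← one_mul (2 * _)]
    exact mul_le_mul h1 ((abs_J_mul_I_add_le hdx).trans h2) (abs_nonneg _) zero_le_one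
  · filter_upwards [ae_restrict_mem measurableSet_Ioi] with x hx d hd
    exact hasDerivAt_scaledIntegrand hd.1 hx

theorem scaledIntegral_zero : scaledIntegral 0 = 0 := by
  simp [scaledIntegral]

/-- For 0 ≤ b < 1/2 the scaled integral is at most b³ times a fixed constant: b² from the scaling
and b from J₁. -/
theorem continuousWithinAt_scaledIntegral_zero :
    ContinuousWithinAt scaledIntegral (Set.Ici 0) 0 := by
  set M := ∫ x in Set.Ioi (0 : ℝ), ‖Real.exp (1 / 2 * x) * (x * Y 0 x * (x * K 0 x))‖ with hM
  rw [ContinuousWithinAt, scaledIntegral_zero]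
  refine squeeze_zero_norm' (a := fun b : ℝ => b ^ 3 * M) ?_ ?_
  · filter_upwards [self_mem_nhdsWithin,
      mem_nhdsWithin_of_mem_nhds (Iio_mem_nhds (by norm_num : (0 : ℝ) < 1 / 2))] with b hb0 hb1
    have hb0' : 0 ≤ b := hb0
    have hb1' : b < 1 / 2 := hb1
    rw [scaledIntegral, hM, ← integral_const_mul]
    refine norm_integral_le_of_norm_le
      ((integrableOn_exp_mul_Y_mul_K (by norm_num)).norm.const_mul _) ?_
    filter_upwards [ae_restrict_mem measurableSet_Ioi] with x hx
    have hx0 : 0 < x := hx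
    rw [norm_mul, Real.norm_of_nonneg (by positivity : 0 ≤ b ^ 2), Real.norm_eq_abs]
    calc b ^ 2 * |x * J 1 (b * x) * I 1 (b * x) * Y 0 x * K 0 x|
        ≤ b ^ 2 * (b * ‖Real.exp (b * x) * (x * Y 0 x * (x * K 0 x))‖) := by
          gcongr
          exact abs_integrand_le hb0' hx0
      _ ≤ b ^ 2 * (b * ‖Real.exp (1 / 2 * x) * (x * Y 0 x * (x * K 0 x))‖) := by
          rw [norm_mul, norm_mul (Real.exp (1 / 2 * x)), Real.norm_eq_abs, Real.abs_exp,
            Real.norm_eq_abs (Real.exp (1 / 2 * x)), Real.abs_exp]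
          gcongr
      _ = _ := by ring
  · have h : Continuous fun b : ℝ => b ^ 3 * M := by fun_prop
    have := h.tendsto 0
    simp only [ne_eq, OfNat.ofNat_ne_zero, not_false_eq_true, zero_pow, zero_mul] at this
    exact this.mono_left nhdsWithin_le_nhds

theorem hasDerivAt_log_one_sub_pow {b : ℝ} (hb : 0 < 1 - b ^ 4) :
    HasDerivAt (fun b : ℝ => (2 * Real.pi)⁻¹ * Real.log (1 - b ^ 4))
      (-(2 * b ^ 3 / (Real.pi * (1 - b ^ 4)))) b := by
  refine ((((hasDerivAt_pow 4 b).const_sub 1).log hb.ne').const_mul _).congr_deriv ?_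
  have := Real.pi_ne_zero
  have := hb.ne'
  field_simp
  norm_num

theorem scaledIntegral_eq {a : ℝ} (ha0 : 0 < a) (ha1 : a < 1) :
    scaledIntegral a = -(2 * Real.pi)⁻¹ * Real.log (1 - a ^ 4) := by
  have hpos : ∀ b, 0 ≤ b → b ≤ a → 0 < 1 - b ^ 4 := fun b h0 h1 =>
    sub_pos.2 (pow_lt_one₀ h0 (h1.trans_lt ha1) (by norm_num))
  -- The mean value theorem on [0, a] applies to the sum with the logarithm, whose derivative is
  -- identically zero on the open interval; hence the values at 0 and a agree.
  obtain ⟨c, -, hc⟩ := exists_hasDerivAt_eq_slope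
    (scaledIntegral + fun b : ℝ => (2 * Real.pi)⁻¹ * Real.log (1 - b ^ 4))
    (fun b => 2 * b ^ 3 / (Real.pi * (1 - b ^ 4)) + -(2 * b ^ 3 / (Real.pi * (1 - b ^ 4)))) ha0
    (by
      refine ContinuousOn.add (fun b hb => ?_) fun b hb =>
        (hasDerivAt_log_one_sub_pow (hpos b hb.1 hb.2)).continuousAt.continuousWithinAt
      rcases hb.1.eq_or_lt with rfl | h0
      · exact continuousWithinAt_scaledIntegral_zero.mono Set.Icc_subset_Ici_self
      · exact (hasDerivAt_scaledIntegral h0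
          (hb.2.trans_lt ha1)).continuousAt.continuousWithinAt)
    (fun b hb => (hasDerivAt_scaledIntegral hb.1 (hb.2.trans ha1)).add
      (hasDerivAt_log_one_sub_pow (hpos b hb.1.le hb.2.le)))
  rw [add_neg_cancel, eq_comm, div_eq_zero_iff, or_iff_left (by linarith)] at hc
  simp only [Pi.add_apply, scaledIntegral_zero, ne_eq, OfNat.ofNat_ne_zero, not_false_eq_true,
    zero_pow, sub_zero, Real.log_one, mul_zero, add_zero] at hc
  linarith

end BesselFn

theorem mainTheorem11 (a : ℝ) (ha0 : 0 < a) (ha1 : a < 1) :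
    MeasureTheory.IntegrableOn
      (fun x : ℝ => x * BesselFn.J 1 (a * x) * BesselFn.I 1 (a * x) * BesselFn.Y 0 x * BesselFn.K 0 x)
      (Set.Ioi 0) MeasureTheory.volume ∧
    ∫ x in Set.Ioi (0 : ℝ),
        x * BesselFn.J 1 (a * x) * BesselFn.I 1 (a * x) * BesselFn.Y 0 x * BesselFn.K 0 x
      = -(2 * Real.pi * a ^ 2)⁻¹ * Real.log (1 - a ^ 4) := by
  refine ⟨BesselFn.integrableOn_integrand ha0.le ha1, ?_⟩
  have h := BesselFn.scaledIntegral_eq ha0 ha1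
  rw [BesselFn.scaledIntegral, MeasureTheory.integral_const_mul, mul_comm,
    ← eq_div_iff (by positivity)] at h
  rw [h, mul_inv, div_eq_mul_inv]
  ring
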